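/- **Proposition (shared structure in the diagonal blocks of the Hessian at transformer equilibrium).** Let $U_C\in\mathbb R^{d\times M}$ have orthonormal columns, let $u_q\in\mathbb R^d$ satisfy $U_C^\top u_q=0$, let $\phi:\mathbb R\to\mathbb R$, and consider the simplified transformer block $$h=\phi(W^\top f),\qquad f=U_C\big(\exp(z)\odot x\big)+u_q,\qquad W\in\mathbb R^{d\times n},\ z\in\mathbb R^{M},$$ where $W$ and the attention logits $z$ of the query $q$ are trainable. Let $\mathbb E$ be the expectation over the full batch (all of whose samples have query $q$), where each sample carries an input $x\in\mathbb R^M$ and a loss $\ell(h)$; put $L=\mathbb E[\ell(h)]$, $g_{h_k}=\partial\ell/\partial h_k$ and $h'_k=\phi'((W^\top f)_k)$. The block is trained by full-batch gradient dynamics in continuous time from $W(0)=0$, $z(0)=0$ (with $g$ carrying the sign convention, so that training follows $+g$): $$\dot W=\frac{\partial L}{\partial W}:=\mathbb E\big[f\,(g_h\odot h')^\top\big],\qquad \dot z=\frac{\partial L}{\partial z}:=\mathbb E\Big[\exp(z)\odot x\odot U_C^\top\sum_k g_{h_k}h_k'w_k\Big].$$ Let $0<T\le\infty$ be the lifetime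 of the trajectory: it is defined on $[0,T)$, and $T=\infty$ or the trajectory is unbounded on $[0,T)$. Assume that the back-propagated gradient is stationary: on an open set of parameters $(W,z)$ that contains the trajectory for $0<t<T$, the expectations $\mathbb E[g_{h_k}h_k'x_l]=\mu_{lk}$ and $\mathbb E[g_{h_k}h_k']$ exist and are constant. Let the Hessian with respect to $W$ be $$\mathbf H(W)_{sk,s'k'}=\frac{\partial}{\partial w_{s'k'}}\Big[\frac{\partial L}{\partial w_{sk}}\big(W,z(W)\big)\Big],\qquad z(W)=\tfrac12\sum_{k}(U_C^\top w_k)^{2}\ \text{(entrywise square)},$$ that is, the attention logits in the first derivative are expressed through $W$ by the relation $z=\frac12\sum_k (U_C^\top w_k)^2$ of the joint dynamics. Assume the following non-degeneracy: there is an index $l_0$ with $\|\mu_{l}\|_2<\|\mu_{l_0}\|_2$ for all $l\ne l_0$ (where $\mu_l=(\mu_{lk})_k$ is the $l$-th row), $\mu_{l_0k}\neq0$ for all $k$, and $\sum_s (U_C)_{sl_0}\ne0$. Then, as $t\to T$, the normalized diagonal blocks of the Hessian converge to a common limit: for each $k$ the sum $\sum_{r,r'}\mathbf H(W(t))_{rk,r'k}$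 is non-zero for all $t<T$ close enough to $T$ (all large enough $t$, if $T=\infty$), and there is a matrix $A\in\mathbb R^{d\times d}$, independent of $k$, such that $$\frac{\mathbf H(W(t))_{sk,s'k}}{\sum_{r,r'}\mathbf H(W(t))_{rk,r'k}}\ \longrightarrow\ A_{ss'}\qquad\text{for all }1\le s,s'\le d,\ 1\le k\le n .$$ -/

import Mathlib

open Filter Topology MeasureTheory

/-- A simplified transformer block with embedding dimension `d`, `M` context tokens and `n` hidden
units, for one fixed query token `q`: the context embeddings (columns of `UC`), the embedding `uq`
of the query, and the activation `φ`. The trainable parameters are the MLP weights `W` and the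
attention logits `z` of the query. -/
structure STB (d M n : ℕ) where
  UC : Matrix (Fin d) (Fin M) ℝ
  uq : Fin d → ℝ
  φ : ℝ → ℝ

noncomputable section

namespace STB

variable {d M n : ℕ}

/-- `f = U_C (exp(z) ⊙ x) + u_q`. -/
def feature (B : STB d M n) (z x : Fin M → ℝ) (s : Fin d) : ℝ :=
  ∑ l, B.UC s l * (Real.exp (z l) * x l) + B.uq s

/-- The pre-activation `(Wᵀ f)_k`. -/
def preact (B : STB d M n) (W : Matrix (Fin d) (Fin n) ℝ) (z x : Fin M → ℝ) (k : Fin n) : ℝ :=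
  ∑ s, W s k * B.feature z x s

/-- The output `h = φ(Wᵀ (U_C (exp(z) ⊙ x) + u_q))`. -/
def output (B : STB d M n) (W : Matrix (Fin d) (Fin n) ℝ) (z x : Fin M → ℝ) (k : Fin n) : ℝ :=
  B.φ (B.preact W z x k)

/-- `g_{h_k} h_k'`: the back-propagated gradient `g_{h_k} = ∂ℓ/∂h_k` of a sample loss `ℓ`, taken at
the output of the block on `x`, times `h_k' = φ'((Wᵀ f)_k)`. -/
def backprop (B : STB d M n) (ℓ : (Fin n → ℝ) → ℝ) (W : Matrix (Fin d) (Fin n) ℝ)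
    (z x : Fin M → ℝ) (k : Fin n) : ℝ :=
  deriv (fun r => ℓ (Function.update (B.output W z x) k r)) (B.output W z x k)
    * deriv B.φ (B.preact W z x k)

/-- Embedding assumption: `U_C` has orthonormal columns, and `u_q` is orthogonal to them. -/
def OrthogonalEmbeddings (B : STB d M n) : Prop :=
  B.UC.transpose * B.UC = 1 ∧ ∀ l, ∑ s, B.UC s l * B.uq s = 0

variable {Ω : Type*} [MeasurableSpace Ω]

/-- The full-batch gradient of the loss with respect to `W`, that is `𝔼[f (g_h ⊙ h')ᵀ]`.
A sample `ω`, drawn from the law `P` of the batch, consists of the input `x ω` and of the sample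
loss `ℓ ω` as a function of the output of the block. -/
def gradW (B : STB d M n) (P : Measure Ω) (x : Ω → Fin M → ℝ) (ℓ : Ω → (Fin n → ℝ) → ℝ)
    (W : Matrix (Fin d) (Fin n) ℝ) (z : Fin M → ℝ) (s : Fin d) (k : Fin n) : ℝ :=
  ∫ ω, B.feature z (x ω) s * B.backprop (ℓ ω) W z (x ω) k ∂P

/-- The full-batch gradient of the loss with respect to `z`, that is `𝔼[(∂b/∂z)ᵀ U_Cᵀ g_f]` with
`b = exp(z) ⊙ x` and `g_f = ∑ₖ g_{h_k} h_k' w_k`. -/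
def gradz (B : STB d M n) (P : Measure Ω) (x : Ω → Fin M → ℝ) (ℓ : Ω → (Fin n → ℝ) → ℝ)
    (W : Matrix (Fin d) (Fin n) ℝ) (z : Fin M → ℝ) (l : Fin M) : ℝ :=
  ∫ ω, Real.exp (z l) * x ω l *
    ∑ s, B.UC s l * ∑ k, B.backprop (ℓ ω) W z (x ω) k * W s k ∂P

/-- Stationary back-propagated gradient: on the set `S` of parameters `(W, z)`, the expectations
`𝔼[g_{h_k} h_k' x_l]` and `𝔼[g_{h_k} h_k']` exist and keep the constant values `μ l k`, `ν k`. -/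
def StationaryOn (B : STB d M n) (P : Measure Ω) (x : Ω → Fin M → ℝ) (ℓ : Ω → (Fin n → ℝ) → ℝ)
    (S : Set (Matrix (Fin d) (Fin n) ℝ × (Fin M → ℝ)))
    (μ : Matrix (Fin M) (Fin n) ℝ) (ν : Fin n → ℝ) : Prop :=
  ∀ W z, (W, z) ∈ S → ∀ k,
    (∀ l, Integrable (fun ω => B.backprop (ℓ ω) W z (x ω) k * x ω l) P ∧
      ∫ ω, B.backprop (ℓ ω) W z (x ω) k * x ω l ∂P = μ l k) ∧
    Integrable (fun ω => B.backprop (ℓ ω) W z (x ω) k) P ∧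
      ∫ ω, B.backprop (ℓ ω) W z (x ω) k ∂P = ν k

/-- `(W, z)` is a trajectory on `[0, T)` of full-batch training in continuous time,
`Ẇ = ∂L/∂W`, `ż = ∂L/∂z`, started from zero. The differential equation is imposed for `t > 0`
only, so that an activation with a kink at `0`, such as ReLU, is allowed. -/
structure IsTraining (B : STB d M n) (P : Measure Ω) (x : Ω → Fin M → ℝ)
    (ℓ : Ω → (Fin n → ℝ) → ℝ) (T : EReal)
    (W : ℝ → Matrix (Fin d) (Fin n) ℝ) (z : ℝ → Fin M → ℝ) : Prop where
  W_zero : W 0 = 0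
  z_zero : z 0 = 0
  W_cont : ContinuousWithinAt W (Set.Ici 0) 0
  z_cont : ContinuousWithinAt z (Set.Ici 0) 0
  W_deriv : ∀ t : ℝ, 0 < t → (t : EReal) < T → ∀ s k,
    HasDerivAt (fun τ => W τ s k) (B.gradW P x ℓ (W t) (z t) s k) t
  z_deriv : ∀ t : ℝ, 0 < t → (t : EReal) < T → ∀ l,
    HasDerivAt (fun τ => z τ l) (B.gradz P x ℓ (W t) (z t) l) t

/-- `T` is the lifetime of the trajectory `(W, z)` on `[0, T)`: it is infinite, or the trajectory is
unbounded on `[0, T)`. -/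
def IsLifetime (T : EReal) (W : ℝ → Matrix (Fin d) (Fin n) ℝ) (z : ℝ → Fin M → ℝ) : Prop :=
  T = ⊤ ∨ ∀ R : ℝ, ∃ t : ℝ, 0 ≤ t ∧ (t : EReal) < T ∧
    ((∃ s k, R < |W t s k|) ∨ ∃ l, R < |z t l|)

/-- The attention logits attached to `W` by the joint dynamics of MLP and attention started from
zero: `z = ½ ∑ₖ vₖ²` (entrywise squares), where `vₖ = U_Cᵀ wₖ`. -/
def jointLogits (B : STB d M n) (W : Matrix (Fin d) (Fin n) ℝ) (l : Fin M) : ℝ :=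
  (1 / 2) * ∑ k, ((B.UC.transpose * W) l k) ^ 2

/-- The Hessian entry `H_{sk,s'k'} = ∂/∂w_{s'k'} (∂L/∂w_{sk})`. The first derivative `∂L/∂w_{sk}` is
the full-batch gradient, considered as a function of `W` alone: the attention logits are the ones
that the joint dynamics attaches to `W`. -/
def hessian (B : STB d M n) (P : Measure Ω) (x : Ω → Fin M → ℝ) (ℓ : Ω → (Fin n → ℝ) → ℝ)
    (W : Matrix (Fin d) (Fin n) ℝ) (s : Fin d) (k : Fin n) (s' : Fin d) (k' : Fin n) : ℝ :=
  deriv (fun r : ℝ => B.gradW P x ℓ (W + Matrix.single s' k' r)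
    (B.jointLogits (W + Matrix.single s' k' r)) s k) 0

/-- The sum `∑_{s,s'} H_{sk,s'k}` of the entries of the `k`-th diagonal block. -/
def blockSum (B : STB d M n) (P : Measure Ω) (x : Ω → Fin M → ℝ) (ℓ : Ω → (Fin n → ℝ) → ℝ)
    (W : Matrix (Fin d) (Fin n) ℝ) (k : Fin n) : ℝ :=
  ∑ s, ∑ s', B.hessian P x ℓ W s k s' k

end STB

/-- The filter of real times `t` tending to `T` from below (to `∞`, if `T = ⊤`). -/
def timeTo (T : EReal) : Filter ℝ :=
  Filter.comap ((↑) : ℝ → EReal) (𝓝[<] T)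

end

/-!
Stationarity makes both gradients explicit. With `v = U_Cᵀ W`, orthogonality of the embeddings gives
`v̇_{lk} = exp(z_l) μ_{lk}` and `ż_l = exp(z_l) ∑ₖ μ_{lk} v_{lk} = ∑ₖ v_{lk} v̇_{lk}`, so that
`z = ½ ∑ₖ vₖ²` along the trajectory (`STB.IsTraining.jointLogits_eq`), and the row `v_l` stays on the
line spanned by `μ_l` (`STB.IsTraining.v_eq`). Its signed length `a_l`, the *amplitude*, satisfies
`z_l = a_l² / 2` and `ȧ_l = ‖μ_l‖ exp(a_l² / 2)`, so `G(a_l(t)) = ‖μ_l‖ t` for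
`G(a) = ∫₀ᵃ exp(-y² / 2) dy` (`STB.IsTraining.gaussPrimitive_amplitude`).

Since `G` is bounded, the lifetime `T` is finite. Since `G` is increasing, `a_{l₀}` is the largest
amplitude, and for `l ≠ l₀` the amplitude `a_l(t)` is at most `a_{l₀}` at the time
`T ‖μ_l‖ / ‖μ_{l₀}‖ < T`, hence bounded (`STB.IsTraining.exists_amplitude_le`). As
`W = U_C v + t u_q νᵀ`, the trajectory could not be unbounded if `a_{l₀}` were bounded; so
`a_{l₀} → ∞` (`STB.IsTraining.tendsto_amplitude`).

Differentiating the explicit gradient, the `k`-th diagonal block of the Hessian is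
`∑_l exp(z_l) μ_{lk} v_{lk} u_l u_lᵀ`, with `u_l` the columns of `U_C`
(`STB.StationaryOn.hessian_eq`). Its weight at `l₀` diverges and the others stay bounded, so the
normalized block converges to `u_{l₀} u_{l₀}ᵀ / (∑ₛ (u_{l₀})ₛ)²`, whatever `k`.
-/

/-! ### Time on `[0, T)` -/

/-- A function on `[0, T)` whose derivative is the constant `c` in the interior is affine. -/
theorem eq_add_mul_of_hasDerivAt_const {T : EReal} {f : ℝ → ℝ} {c : ℝ}
    (hf0 : ContinuousWithinAt f (Set.Ici 0) 0)
    (hf : ∀ t : ℝ, 0 < t → (t : EReal) < T → HasDerivAt f c t)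
    {t : ℝ} (ht0 : 0 ≤ t) (htT : (t : EReal) < T) : f t = f 0 + c * t := by
  rcases ht0.eq_or_lt with rfl | ht
  · simp
  have hlt : ∀ y : ℝ, y ≤ t → (y : EReal) < T := fun y hy =>
    lt_of_le_of_lt (EReal.coe_le_coe_iff.2 hy) htT
  have hcont : ContinuousOn f (Set.Icc 0 t) := by
    intro y hy
    rcases hy.1.eq_or_lt with rfl | hy0
    · exact hf0.mono Set.Icc_subset_Ici_self
    · exact (hf y hy0 (hlt y hy.2)).continuousAt.continuousWithinAt
  obtain ⟨_, _, hy⟩ := exists_hasDerivAt_eq_slope f (fun _ => c) ht hcont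
    fun y hy => hf y hy.1 (hlt y hy.2.le)
  rw [hy]
  field_simp
  ring

/-- Just before `T` means after `t₀` and before `T`, for any `t₀ < T`. -/
theorem eventually_timeTo {T : EReal} {t₀ : ℝ} (h : (t₀ : EReal) < T) :
    ∀ᶠ t in timeTo T, t₀ < t ∧ (t : EReal) < T := by
  have := (Ioo_mem_nhdsLT h : Set.Ioo (t₀ : EReal) T ∈ 𝓝[<] T)
  filter_upwards [Filter.preimage_mem_comap this] with t ht
  exact ⟨EReal.coe_lt_coe_iff.1 ht.1, ht.2⟩

/-! ### The Gaussian primitive -/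

/-- The primitive of `exp (-y² / 2)` that vanishes at `0`; it turns the equation
`a' = m exp (a² / 2)` into `(gaussPrimitive a)' = m`. -/
noncomputable def gaussPrimitive (a : ℝ) : ℝ := ∫ y in (0 : ℝ)..a, Real.exp (-(y ^ 2 / 2))

theorem hasDerivAt_gaussPrimitive (a : ℝ) :
    HasDerivAt gaussPrimitive (Real.exp (-(a ^ 2 / 2))) a := by
  have hc : Continuous fun y : ℝ => Real.exp (-(y ^ 2 / 2)) := by fun_prop
  exact intervalIntegral.integral_hasDerivAt_right (hc.intervalIntegrable _ _)
    (hc.stronglyMeasurableAtFilter _ _) hc.continuousAt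

theorem gaussPrimitive_zero : gaussPrimitive 0 = 0 := by simp [gaussPrimitive]

theorem strictMono_gaussPrimitive : StrictMono gaussPrimitive :=
  strictMono_of_deriv_pos fun a => by
    rw [(hasDerivAt_gaussPrimitive a).deriv]
    exact Real.exp_pos _

theorem exists_gaussPrimitive_le : ∃ C : ℝ, ∀ a, gaussPrimitive a ≤ C := by
  have hi : Integrable fun y : ℝ => Real.exp (-(y ^ 2 / 2)) := by
    convert integrable_exp_neg_mul_sq (b := 1 / 2) (by norm_num) using 3
    ring
  refine ⟨∫ y, Real.exp (-(y ^ 2 / 2)), fun a => ?_⟩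
  rcases le_total 0 a with ha | ha
  · rw [gaussPrimitive, intervalIntegral.integral_of_le ha]
    exact setIntegral_le_integral hi (Eventually.of_forall fun _ => (Real.exp_pos _).le)
  · exact (strictMono_gaussPrimitive.monotone ha).trans <| by
      rw [gaussPrimitive_zero]
      exact integral_nonneg fun _ => (Real.exp_pos _).le

/-! ### Gradients and Hessian under stationarity -/

namespace STB

variable {d M n : ℕ} {B : STB d M n} {Ω : Type*} [MeasurableSpace Ω] {P : Measure Ω}
  {x : Ω → Fin M → ℝ} {ℓ : Ω → (Fin n → ℝ) → ℝ}
  {S : Set (Matrix (Fin d) (Fin n) ℝ × (Fin M → ℝ))}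
  {μ : Matrix (Fin M) (Fin n) ℝ} {ν : Fin n → ℝ}

theorem StationaryOn.gradW_eq (h : B.StationaryOn P x ℓ S μ ν)
    {W : Matrix (Fin d) (Fin n) ℝ} {z : Fin M → ℝ} (hS : (W, z) ∈ S) (s : Fin d) (k : Fin n) :
    B.gradW P x ℓ W z s k = ∑ l, B.UC s l * Real.exp (z l) * μ l k + B.uq s * ν k := by
  obtain ⟨h1, h2, h3⟩ := h W z hS k
  have heq : ∀ ω, B.feature z (x ω) s * B.backprop (ℓ ω) W z (x ω) k =
      ∑ l, B.UC s l * Real.exp (z l) * (B.backprop (ℓ ω) W z (x ω) k * x ω l)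
        + B.uq s * B.backprop (ℓ ω) W z (x ω) k := by
    intro ω
    rw [feature, add_mul, Finset.sum_mul]
    congr 1
    exact Finset.sum_congr rfl fun l _ => by ring
  simp only [gradW, heq]
  rw [integral_add (integrable_finsetSum _ fun l _ => (h1 l).1.const_mul _) (h2.const_mul _),
    integral_finsetSum _ fun l _ => (h1 l).1.const_mul _, integral_const_mul, h3]
  simp only [integral_const_mul, (h1 _).2]

theorem StationaryOn.gradz_eq (h : B.StationaryOn P x ℓ S μ ν)
    {W : Matrix (Fin d) (Fin n) ℝ} {z : Fin M → ℝ} (hS : (W, z) ∈ S) (l : Fin M) :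
    B.gradz P x ℓ W z l = Real.exp (z l) * ∑ k, μ l k * (B.UC.transpose * W) l k := by
  have heq : ∀ ω, Real.exp (z l) * x ω l *
      ∑ s, B.UC s l * ∑ k, B.backprop (ℓ ω) W z (x ω) k * W s k =
      Real.exp (z l) * ∑ k, (B.backprop (ℓ ω) W z (x ω) k * x ω l) *
        (B.UC.transpose * W) l k := by
    intro ω
    simp only [Matrix.mul_apply, Matrix.transpose_apply, Finset.mul_sum]
    rw [Finset.sum_comm]
    exact Finset.sum_congr rfl fun k _ => Finset.sum_congr rfl fun s _ => by ring
  simp only [gradz, heq]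
  rw [integral_const_mul,
    integral_finsetSum _ fun k _ => ((h W z hS k).1 l).1.mul_const _]
  simp only [integral_mul_const, ((h W z hS _).1 l).2]

theorem hasDerivAt_jointLogits_add_single (B : STB d M n) (W : Matrix (Fin d) (Fin n) ℝ)
    (s : Fin d) (k : Fin n) (l : Fin M) :
    HasDerivAt (fun r : ℝ => B.jointLogits (W + Matrix.single s k r) l)
      ((B.UC.transpose * W) l k * B.UC s l) 0 := by
  have hterm : ∀ k', HasDerivAt
      (fun r : ℝ => ((B.UC.transpose * (W + Matrix.single s k r)) l k') ^ 2)
      (if k' = k then 2 * ((B.UC.transpose * W) l k * B.UC s l) else 0) 0 := by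
    intro k'
    by_cases hk : k' = k
    · subst hk
      have : HasDerivAt (fun r : ℝ => (B.UC.transpose * W) l k' + B.UC s l * r)
          (B.UC s l) 0 := by
        simpa using ((hasDerivAt_id (0 : ℝ)).const_mul (B.UC s l)).const_add
          ((B.UC.transpose * W) l k')
      simpa [Matrix.mul_add, mul_assoc] using this.fun_pow 2
    · simpa [Matrix.mul_add, hk] using hasDerivAt_const (0 : ℝ) _
  have := (HasDerivAt.fun_sum (u := Finset.univ) fun k' _ => hterm k').const_mul (1 / 2 : ℝ)
  simpa [jointLogits] using this

/-- On a stationary open set, the Hessian at a point that satisfies the relation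
`z = ½ ∑ₖ vₖ²` of the joint dynamics. -/
theorem StationaryOn.hessian_eq (h : B.StationaryOn P x ℓ S μ ν) (hS : IsOpen S)
    {W : Matrix (Fin d) (Fin n) ℝ} (hmem : (W, B.jointLogits W) ∈ S)
    (s : Fin d) (k : Fin n) (s' : Fin d) (k' : Fin n) :
    B.hessian P x ℓ W s k s' k' = ∑ l, B.UC s l * B.UC s' l *
      (Real.exp (B.jointLogits W l) * μ l k * (B.UC.transpose * W) l k') := by
  have hsingle : Continuous fun r : ℝ => W + Matrix.single s' k' r := by
    refine continuous_const.add (continuous_matrix fun i j => ?_)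
    simp only [Matrix.single_apply]
    split_ifs <;> fun_prop
  have hcont : ContinuousAt (fun r : ℝ =>
      (W + Matrix.single s' k' r, B.jointLogits (W + Matrix.single s' k' r))) 0 :=
    hsingle.continuousAt.prodMk <| continuousAt_pi.2 fun l =>
      (hasDerivAt_jointLogits_add_single B W s' k' l).continuousAt
  have hev : ∀ᶠ r in 𝓝 (0 : ℝ),
      (W + Matrix.single s' k' r, B.jointLogits (W + Matrix.single s' k' r)) ∈ S :=
    hcont.eventually_mem (hS.mem_nhds (by simpa using hmem))
  have hgrad : (fun r : ℝ => B.gradW P x ℓ (W + Matrix.single s' k' r)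
        (B.jointLogits (W + Matrix.single s' k' r)) s k) =ᶠ[𝓝 0] fun r =>
      ∑ l, B.UC s l * Real.exp (B.jointLogits (W + Matrix.single s' k' r) l) * μ l k
        + B.uq s * ν k :=
    hev.mono fun r hr => h.gradW_eq hr s k
  rw [hessian, hgrad.deriv_eq]
  have hd := ((HasDerivAt.fun_sum (u := Finset.univ) fun l _ =>
    (((hasDerivAt_jointLogits_add_single B W s' k' l).exp.const_mul (B.UC s l)).mul_const
      (μ l k))).add_const (B.uq s * ν k)).deriv
  rw [hd]
  refine Finset.sum_congr rfl fun l _ => ?_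
  simp only [Matrix.single_zero, add_zero]
  ring

/-! ### Integration of the joint dynamics -/

variable {T : EReal} {W : ℝ → Matrix (Fin d) (Fin n) ℝ} {z : ℝ → Fin M → ℝ}

theorem IsTraining.continuousWithinAt_W (hW : B.IsTraining P x ℓ T W z) (s : Fin d) (k : Fin n) :
    ContinuousWithinAt (fun t => W t s k) (Set.Ici 0) 0 :=
  ((continuous_apply_apply s k).continuousAt (x := W 0)).comp_continuousWithinAt hW.W_cont

theorem IsTraining.continuousWithinAt_v (hW : B.IsTraining P x ℓ T W z) (l : Fin M) (k : Fin n) :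
    ContinuousWithinAt (fun t => (B.UC.transpose * W t) l k) (Set.Ici 0) 0 := by
  simp only [Matrix.mul_apply]
  exact tendsto_finsetSum _ fun s _ =>
    (continuousWithinAt_const (b := B.UC.transpose l s)).mul (hW.continuousWithinAt_W s k)

theorem IsTraining.v_zero (hW : B.IsTraining P x ℓ T W z) (l : Fin M) (k : Fin n) :
    (B.UC.transpose * W 0) l k = 0 := by
  simp [hW.W_zero]

theorem IsTraining.hasDerivAt_v (hW : B.IsTraining P x ℓ T W z) (hB : B.OrthogonalEmbeddings)
    (h : B.StationaryOn P x ℓ S μ ν)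
    (hmem : ∀ t : ℝ, 0 < t → (t : EReal) < T → (W t, z t) ∈ S)
    {t : ℝ} (ht : 0 < t) (htT : (t : EReal) < T) (l : Fin M) (k : Fin n) :
    HasDerivAt (fun τ => (B.UC.transpose * W τ) l k) (Real.exp (z t l) * μ l k) t := by
  have hd := HasDerivAt.fun_sum (u := Finset.univ) fun s _ =>
    (hW.W_deriv t ht htT s k).const_mul (B.UC s l)
  simp only [Matrix.mul_apply, Matrix.transpose_apply]
  refine hd.congr_deriv ?_
  simp only [h.gradW_eq (hmem t ht htT), mul_add, Finset.sum_add_distrib, Finset.mul_sum]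
  rw [Finset.sum_comm]
  have h1 : ∀ l', ∑ s, B.UC s l * (B.UC s l' * Real.exp (z t l') * μ l' k) =
      (1 : Matrix (Fin M) (Fin M) ℝ) l l' * (Real.exp (z t l') * μ l' k) := by
    intro l'
    rw [← hB.1, Matrix.mul_apply, Finset.sum_mul]
    exact Finset.sum_congr rfl fun s _ => by rw [Matrix.transpose_apply]; ring
  have h2 : ∑ s, B.UC s l * (B.uq s * ν k) = 0 := by
    simp only [← mul_assoc, ← Finset.sum_mul, hB.2 l, zero_mul]
  simp [h1, h2, Matrix.one_apply]

/-- `z = ½ ∑ₖ vₖ²` is a conserved relation of the dynamics started from zero. -/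
theorem IsTraining.jointLogits_eq (hW : B.IsTraining P x ℓ T W z) (hB : B.OrthogonalEmbeddings)
    (h : B.StationaryOn P x ℓ S μ ν)
    (hmem : ∀ t : ℝ, 0 < t → (t : EReal) < T → (W t, z t) ∈ S)
    {t : ℝ} (ht : 0 ≤ t) (htT : (t : EReal) < T) : B.jointLogits (W t) = z t := by
  ext l
  have key := eq_add_mul_of_hasDerivAt_const (T := T) (c := 0)
    (f := fun τ => z τ l - (1 / 2) * ∑ k, ((B.UC.transpose * W τ) l k) ^ 2) ?_ ?_ ht htT
  · simp only [hW.v_zero, hW.z_zero, Pi.zero_apply] at key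
    simp only [jointLogits]
    norm_num at key
    linarith
  · refine ContinuousWithinAt.sub ?_ (continuousWithinAt_const.mul ?_)
    · exact ((continuous_apply l).continuousAt (x := z 0)).comp_continuousWithinAt hW.z_cont
    · exact tendsto_finsetSum _ fun k _ => (hW.continuousWithinAt_v l k).pow 2
  · intro τ hτ hτT
    have hd := (hW.z_deriv τ hτ hτT l).fun_sub ((HasDerivAt.fun_sum (u := Finset.univ) fun k _ =>
      (hW.hasDerivAt_v hB h hmem hτ hτT l k).fun_pow 2).const_mul (1 / 2 : ℝ))
    refine hd.congr_deriv ?_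
    rw [h.gradz_eq (hmem τ hτ hτT), Finset.mul_sum, Finset.mul_sum, ← Finset.sum_sub_distrib]
    refine Finset.sum_eq_zero fun k _ => ?_
    norm_num
    ring

/-- The Euclidean norm `‖μ_l‖` of the `l`-th row. -/
noncomputable def rowNorm (μ : Matrix (Fin M) (Fin n) ℝ) (l : Fin M) : ℝ := √(∑ k, (μ l k) ^ 2)

theorem rowNorm_nonneg (l : Fin M) : 0 ≤ rowNorm μ l := Real.sqrt_nonneg _

theorem rowNorm_sq (l : Fin M) : rowNorm μ l ^ 2 = ∑ k, (μ l k) ^ 2 :=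
  Real.sq_sqrt (Finset.sum_nonneg fun _ _ => sq_nonneg _)

theorem abs_le_rowNorm (l : Fin M) (k : Fin n) : |μ l k| ≤ rowNorm μ l :=
  Real.abs_le_sqrt (Finset.single_le_sum (f := fun k => (μ l k) ^ 2)
    (fun _ _ => sq_nonneg _) (Finset.mem_univ k))

/-- The component of the `l`-th row of `v = U_Cᵀ W` along `μ_l / ‖μ_l‖`; it is `0` if `μ_l = 0`. -/
noncomputable def amplitude (B : STB d M n) (μ : Matrix (Fin M) (Fin n) ℝ) (W : Matrix (Fin d) (Fin n) ℝ)
    (l : Fin M) : ℝ :=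
  (∑ k, μ l k * (B.UC.transpose * W) l k) / rowNorm μ l

theorem IsTraining.continuousWithinAt_amplitude (hW : B.IsTraining P x ℓ T W z) (l : Fin M) :
    ContinuousWithinAt (fun t => B.amplitude μ (W t) l) (Set.Ici 0) 0 :=
  ContinuousWithinAt.div_const (tendsto_finsetSum _ fun k _ =>
    continuousWithinAt_const.mul (hW.continuousWithinAt_v l k)) _

theorem IsTraining.amplitude_zero (hW : B.IsTraining P x ℓ T W z) (l : Fin M) :
    B.amplitude μ (W 0) l = 0 := by
  simp [amplitude, hW.v_zero]

theorem IsTraining.hasDerivAt_amplitude (hW : B.IsTraining P x ℓ T W z)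
    (hB : B.OrthogonalEmbeddings) (h : B.StationaryOn P x ℓ S μ ν)
    (hmem : ∀ t : ℝ, 0 < t → (t : EReal) < T → (W t, z t) ∈ S)
    {t : ℝ} (ht : 0 < t) (htT : (t : EReal) < T) (l : Fin M) :
    HasDerivAt (fun τ => B.amplitude μ (W τ) l) (rowNorm μ l * Real.exp (z t l)) t := by
  have hd := (HasDerivAt.fun_sum (u := Finset.univ) fun k _ =>
    (hW.hasDerivAt_v hB h hmem ht htT l k).const_mul (μ l k)).div_const (rowNorm μ l)
  refine hd.congr_deriv ?_
  have : ∑ k, μ l k * (Real.exp (z t l) * μ l k) = rowNorm μ l ^ 2 * Real.exp (z t l) := by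
    rw [rowNorm_sq, Finset.sum_mul]
    exact Finset.sum_congr rfl fun k _ => by ring
  rw [this]
  rcases eq_or_ne (rowNorm μ l) 0 with h0 | h0
  · simp [h0]
  · field_simp

/-- The rows of `v` stay on the lines spanned by the rows of `μ`. -/
theorem IsTraining.v_eq (hW : B.IsTraining P x ℓ T W z) (hB : B.OrthogonalEmbeddings)
    (h : B.StationaryOn P x ℓ S μ ν)
    (hmem : ∀ t : ℝ, 0 < t → (t : EReal) < T → (W t, z t) ∈ S)
    {t : ℝ} (ht : 0 ≤ t) (htT : (t : EReal) < T) (l : Fin M) (k : Fin n) :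
    (B.UC.transpose * W t) l k = μ l k / rowNorm μ l * B.amplitude μ (W t) l := by
  have key := eq_add_mul_of_hasDerivAt_const (T := T) (c := 0)
    (f := fun τ => (B.UC.transpose * W τ) l k - μ l k / rowNorm μ l * B.amplitude μ (W τ) l)
    ?_ ?_ ht htT
  · simp only [hW.v_zero, hW.amplitude_zero] at key
    linarith
  · exact (hW.continuousWithinAt_v l k).sub
      (continuousWithinAt_const.mul (hW.continuousWithinAt_amplitude l))
  · intro τ hτ hτT
    have hd := (hW.hasDerivAt_v hB h hmem hτ hτT l k).fun_sub
      ((hW.hasDerivAt_amplitude hB h hmem hτ hτT l).const_mul (μ l k / rowNorm μ l))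
    refine hd.congr_deriv ?_
    rcases eq_or_ne (rowNorm μ l) 0 with h0 | h0
    · have : μ l k = 0 := abs_nonpos_iff.1 (h0 ▸ abs_le_rowNorm l k)
      simp [this]
    · field_simp
      ring

theorem IsTraining.logit_eq (hW : B.IsTraining P x ℓ T W z) (hB : B.OrthogonalEmbeddings)
    (h : B.StationaryOn P x ℓ S μ ν)
    (hmem : ∀ t : ℝ, 0 < t → (t : EReal) < T → (W t, z t) ∈ S)
    {t : ℝ} (ht : 0 ≤ t) (htT : (t : EReal) < T) (l : Fin M) :
    z t l = B.amplitude μ (W t) l ^ 2 / 2 := by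
  rw [← hW.jointLogits_eq hB h hmem ht htT, jointLogits]
  simp only [hW.v_eq hB h hmem ht htT, mul_pow, div_pow]
  rw [← Finset.sum_mul, ← Finset.sum_div, ← rowNorm_sq]
  rcases eq_or_ne (rowNorm μ l) 0 with h0 | h0
  · simp [amplitude, h0]
  · field_simp

/-- The Gaussian primitive of the amplitude grows at the constant speed `‖μ_l‖`. -/
theorem IsTraining.gaussPrimitive_amplitude (hW : B.IsTraining P x ℓ T W z)
    (hB : B.OrthogonalEmbeddings) (h : B.StationaryOn P x ℓ S μ ν)
    (hmem : ∀ t : ℝ, 0 < t → (t : EReal) < T → (W t, z t) ∈ S)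
    {t : ℝ} (ht : 0 ≤ t) (htT : (t : EReal) < T) (l : Fin M) :
    gaussPrimitive (B.amplitude μ (W t) l) = rowNorm μ l * t := by
  have key := eq_add_mul_of_hasDerivAt_const (T := T) (c := rowNorm μ l)
    (f := fun τ => gaussPrimitive (B.amplitude μ (W τ) l)) ?_ ?_ ht htT
  · simpa [hW.amplitude_zero, gaussPrimitive_zero] using key
  · exact (hasDerivAt_gaussPrimitive _).continuousAt.comp_continuousWithinAt
      (hW.continuousWithinAt_amplitude l)
  · intro τ hτ hτT
    have hd := (hasDerivAt_gaussPrimitive _).comp τ (hW.hasDerivAt_amplitude hB h hmem hτ hτT l)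
    refine hd.congr_deriv ?_
    rw [hW.logit_eq hB h hmem hτ.le hτT, mul_left_comm, ← Real.exp_add]
    simp

/-- `W = U_C v + t u_q νᵀ`, so `W` can blow up in finite time only through `v`. -/
theorem IsTraining.W_eq (hW : B.IsTraining P x ℓ T W z)
    (hB : B.OrthogonalEmbeddings) (h : B.StationaryOn P x ℓ S μ ν)
    (hmem : ∀ t : ℝ, 0 < t → (t : EReal) < T → (W t, z t) ∈ S)
    {t : ℝ} (ht : 0 ≤ t) (htT : (t : EReal) < T) (s : Fin d) (k : Fin n) :
    W t s k = ∑ l, B.UC s l * (B.UC.transpose * W t) l k + B.uq s * ν k * t := by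
  have key := eq_add_mul_of_hasDerivAt_const (T := T) (c := B.uq s * ν k)
    (f := fun τ => W τ s k - ∑ l, B.UC s l * (B.UC.transpose * W τ) l k) ?_ ?_ ht htT
  · simp only [hW.v_zero, mul_zero, Finset.sum_const_zero] at key
    simp only [hW.W_zero, Matrix.zero_apply] at key
    linarith
  · exact (hW.continuousWithinAt_W s k).sub (tendsto_finsetSum _ fun l _ =>
      (continuousWithinAt_const (b := B.UC s l)).mul (hW.continuousWithinAt_v l k))
  · intro τ hτ hτT
    have hd := (hW.W_deriv τ hτ hτT s k).fun_sub (HasDerivAt.fun_sum (u := Finset.univ) fun l _ =>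
      (hW.hasDerivAt_v hB h hmem hτ hτT l k).const_mul (B.UC s l))
    refine hd.congr_deriv ?_
    rw [h.gradW_eq (hmem τ hτ hτT)]
    simp [mul_assoc]

/-! ### Blow-up of the dominant token -/

theorem IsTraining.amplitude_nonneg (hW : B.IsTraining P x ℓ T W z)
    (hB : B.OrthogonalEmbeddings) (h : B.StationaryOn P x ℓ S μ ν)
    (hmem : ∀ t : ℝ, 0 < t → (t : EReal) < T → (W t, z t) ∈ S)
    {t : ℝ} (ht : 0 ≤ t) (htT : (t : EReal) < T) (l : Fin M) :
    0 ≤ B.amplitude μ (W t) l := by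
  rw [← strictMono_gaussPrimitive.le_iff_le, hW.gaussPrimitive_amplitude hB h hmem ht htT,
    gaussPrimitive_zero]
  exact mul_nonneg (rowNorm_nonneg l) ht

/-- All amplitudes are values of one increasing function at the times `‖μ_l‖ t`. -/
theorem IsTraining.amplitude_le_iff (hW : B.IsTraining P x ℓ T W z)
    (hB : B.OrthogonalEmbeddings) (h : B.StationaryOn P x ℓ S μ ν)
    (hmem : ∀ t : ℝ, 0 < t → (t : EReal) < T → (W t, z t) ∈ S)
    {t t' : ℝ} (ht : 0 ≤ t) (htT : (t : EReal) < T) (ht' : 0 ≤ t') (htT' : (t' : EReal) < T)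
    (l l' : Fin M) :
    B.amplitude μ (W t) l ≤ B.amplitude μ (W t') l' ↔ rowNorm μ l * t ≤ rowNorm μ l' * t' := by
  rw [← strictMono_gaussPrimitive.le_iff_le, hW.gaussPrimitive_amplitude hB h hmem ht htT,
    hW.gaussPrimitive_amplitude hB h hmem ht' htT']

theorem IsTraining.abs_v_le (hW : B.IsTraining P x ℓ T W z)
    (hB : B.OrthogonalEmbeddings) (h : B.StationaryOn P x ℓ S μ ν)
    (hmem : ∀ t : ℝ, 0 < t → (t : EReal) < T → (W t, z t) ∈ S)
    {t : ℝ} (ht : 0 ≤ t) (htT : (t : EReal) < T) (l : Fin M) (k : Fin n) :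
    |(B.UC.transpose * W t) l k| ≤ B.amplitude μ (W t) l := by
  have ha := hW.amplitude_nonneg hB h hmem ht htT l
  rw [hW.v_eq hB h hmem ht htT, abs_mul, abs_div, abs_of_nonneg ha,
    abs_of_nonneg (rowNorm_nonneg l)]
  exact mul_le_of_le_one_left ha (div_le_one_of_le₀ (abs_le_rowNorm l k) (rowNorm_nonneg l))

/-- A trajectory with a non-zero row of `μ` blows up in finite time, as the Gaussian primitive is
bounded. -/
theorem IsTraining.exists_lifetime_eq (hW : B.IsTraining P x ℓ T W z)
    (hB : B.OrthogonalEmbeddings) (h : B.StationaryOn P x ℓ S μ ν)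
    (hmem : ∀ t : ℝ, 0 < t → (t : EReal) < T → (W t, z t) ∈ S) (hT : 0 < T)
    {l₀ : Fin M} (hpos : 0 < rowNorm μ l₀) : ∃ T' : ℝ, 0 < T' ∧ T = T' := by
  obtain ⟨C, hC⟩ := exists_gaussPrimitive_le
  have hne : T ≠ ⊤ := by
    rintro rfl
    -- a time at which the primitive would exceed its bound
    have ht : (0 : ℝ) ≤ (|C| + 1) / rowNorm μ l₀ := by positivity
    have := hC (B.amplitude μ (W ((|C| + 1) / rowNorm μ l₀)) l₀)
    rw [hW.gaussPrimitive_amplitude hB h hmem ht (EReal.coe_lt_top _),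
      mul_div_cancel₀ _ hpos.ne'] at this
    linarith [le_abs_self C]
  lift T to ℝ using ⟨hne, (bot_le.trans_lt hT).ne'⟩
  exact ⟨T, EReal.coe_pos.1 hT, rfl⟩

/-- The amplitude of the dominant token diverges: it dominates all other amplitudes, and the
trajectory, which is unbounded, is controlled by the amplitudes. -/
theorem IsTraining.tendsto_amplitude (hW : B.IsTraining P x ℓ T W z)
    (hB : B.OrthogonalEmbeddings) (h : B.StationaryOn P x ℓ S μ ν)
    (hmem : ∀ t : ℝ, 0 < t → (t : EReal) < T → (W t, z t) ∈ S) (hT : 0 < T)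
    (hlife : STB.IsLifetime T W z) {l₀ : Fin M} (hpos : 0 < rowNorm μ l₀)
    (hle : ∀ l, rowNorm μ l ≤ rowNorm μ l₀) :
    Tendsto (fun t => B.amplitude μ (W t) l₀) (timeTo T) atTop := by
  obtain ⟨T', hT', rfl⟩ := hW.exists_lifetime_eq hB h hmem hT hpos
  rw [tendsto_atTop]
  intro K
  suffices hex : ∃ t₀ : ℝ, 0 ≤ t₀ ∧ (t₀ : EReal) < T' ∧ K ≤ B.amplitude μ (W t₀) l₀ by
    obtain ⟨t₀, h0, h1, h2⟩ := hex
    filter_upwards [eventually_timeTo h1] with t ht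
    refine h2.trans ((hW.amplitude_le_iff hB h hmem h0 h1 (h0.trans ht.1.le) ht.2 l₀ l₀).2 ?_)
    exact mul_le_mul_of_nonneg_left ht.1.le hpos.le
  by_contra! hcon
  have hbound : ∀ t : ℝ, 0 ≤ t → (t : EReal) < T' → ∀ l, B.amplitude μ (W t) l ≤ K :=
    fun t ht htT l => ((hW.amplitude_le_iff hB h hmem ht htT ht htT l l₀).2
      (mul_le_mul_of_nonneg_right (hle l) ht)).trans (hcon t ht htT).le
  set RW : Fin d → Fin n → ℝ := fun s k => ∑ l, |B.UC s l| * K + |B.uq s * ν k| * T' with hRW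
  have hK : 0 ≤ K := (hW.amplitude_nonneg hB h hmem le_rfl hT l₀).trans
    (hbound 0 le_rfl hT l₀)
  have hRW0 : ∀ s k, 0 ≤ RW s k := fun s k => by positivity
  obtain hlife | hlife := hlife
  · exact EReal.coe_ne_top _ hlife
  obtain ⟨t, ht, htT, ⟨s, k, hsk⟩ | ⟨l, hl⟩⟩ := hlife (K ^ 2 / 2 + ∑ s, ∑ k, RW s k)
  · refine hsk.not_ge (le_trans (b := RW s k) ?_ ?_)
    · rw [hW.W_eq hB h hmem ht htT, hRW]
      refine (abs_add_le _ _).trans (add_le_add ((Finset.abs_sum_le_sum_abs _ _).trans ?_) ?_)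
      · refine Finset.sum_le_sum fun l _ => ?_
        rw [abs_mul]
        exact mul_le_mul_of_nonneg_left
          ((hW.abs_v_le hB h hmem ht htT l k).trans (hbound t ht htT l)) (abs_nonneg _)
      · rw [abs_mul _ t, abs_of_nonneg ht]
        exact mul_le_mul_of_nonneg_left (EReal.coe_le_coe_iff.1 htT.le) (abs_nonneg _)
    · calc RW s k ≤ ∑ k, RW s k :=
            Finset.single_le_sum (fun k _ => hRW0 s k) (Finset.mem_univ k)
        _ ≤ ∑ s, ∑ k, RW s k :=
            Finset.single_le_sum (f := fun s => ∑ k, RW s k)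
              (fun s _ => Finset.sum_nonneg fun k _ => hRW0 s k) (Finset.mem_univ s)
        _ ≤ _ := le_add_of_nonneg_left (by positivity)
  · refine hl.not_ge ?_
    have ha := hW.amplitude_nonneg hB h hmem ht htT l
    rw [hW.logit_eq hB h hmem ht htT, abs_of_nonneg (by positivity)]
    have h1 : B.amplitude μ (W t) l ^ 2 ≤ K ^ 2 := pow_le_pow_left₀ ha (hbound t ht htT l) 2
    have h2 : 0 ≤ ∑ s, ∑ k, RW s k :=
      Finset.sum_nonneg fun s _ => Finset.sum_nonneg fun k _ => hRW0 s k
    linarith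

/-- A token with `‖μ_l‖ < ‖μ_{l₀}‖` has bounded amplitude: at time `t` it is below the amplitude of
`l₀` at the time `T ‖μ_l‖ / ‖μ_{l₀}‖ < T`. -/
theorem IsTraining.exists_amplitude_le (hW : B.IsTraining P x ℓ T W z)
    (hB : B.OrthogonalEmbeddings) (h : B.StationaryOn P x ℓ S μ ν)
    (hmem : ∀ t : ℝ, 0 < t → (t : EReal) < T → (W t, z t) ∈ S) (hT : 0 < T)
    {l l₀ : Fin M} (hlt : rowNorm μ l < rowNorm μ l₀) :
    ∃ K : ℝ, ∀ t : ℝ, 0 ≤ t → (t : EReal) < T → B.amplitude μ (W t) l ≤ K := by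
  have hpos := (rowNorm_nonneg l).trans_lt hlt
  obtain ⟨T', hT', rfl⟩ := hW.exists_lifetime_eq hB h hmem hT hpos
  set t₁ := rowNorm μ l / rowNorm μ l₀ * T' with ht₁
  have h0 : 0 ≤ t₁ := mul_nonneg (div_nonneg (rowNorm_nonneg l) hpos.le) hT'.le
  have h1 : (t₁ : EReal) < T' :=
    EReal.coe_lt_coe_iff.2 (mul_lt_of_lt_one_left hT' ((div_lt_one hpos).2 hlt))
  refine ⟨B.amplitude μ (W t₁) l₀, fun t ht htT => ?_⟩
  rw [hW.amplitude_le_iff hB h hmem ht htT h0 h1, ht₁, ← mul_assoc, mul_div_cancel₀ _ hpos.ne']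
  exact mul_le_mul_of_nonneg_left (EReal.coe_le_coe_iff.1 htT.le) (rowNorm_nonneg l)

/-- The weight of the rank-one matrix `u_l u_lᵀ` in the `k`-th diagonal block of the Hessian, where
`u_l` is the `l`-th column of `U_C`. -/
noncomputable def blockWeight (B : STB d M n) (μ : Matrix (Fin M) (Fin n) ℝ) (W : Matrix (Fin d) (Fin n) ℝ)
    (k : Fin n) (l : Fin M) : ℝ :=
  Real.exp (B.jointLogits W l) * μ l k * (B.UC.transpose * W) l k

theorem IsTraining.tendsto_blockWeight (hW : B.IsTraining P x ℓ T W z)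
    (hB : B.OrthogonalEmbeddings) (h : B.StationaryOn P x ℓ S μ ν)
    (hmem : ∀ t : ℝ, 0 < t → (t : EReal) < T → (W t, z t) ∈ S) (hT : 0 < T)
    (hlife : STB.IsLifetime T W z) {l₀ : Fin M} (hpos : 0 < rowNorm μ l₀)
    (hle : ∀ l, rowNorm μ l ≤ rowNorm μ l₀) {k : Fin n} (hk : μ l₀ k ≠ 0) :
    Tendsto (fun t => B.blockWeight μ (W t) k l₀) (timeTo T) atTop := by
  have hlim : Tendsto (fun t => μ l₀ k ^ 2 / rowNorm μ l₀ * B.amplitude μ (W t) l₀)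
      (timeTo T) atTop :=
    (hW.tendsto_amplitude hB h hmem hT hlife hpos hle).const_mul_atTop (by positivity)
  refine tendsto_atTop_mono' _ ?_ hlim
  filter_upwards [eventually_timeTo (t₀ := 0) hT] with t ht
  have ha := hW.amplitude_nonneg hB h hmem ht.1.le ht.2 l₀
  rw [blockWeight, hW.jointLogits_eq hB h hmem ht.1.le ht.2, hW.v_eq hB h hmem ht.1.le ht.2,
    hW.logit_eq hB h hmem ht.1.le ht.2]
  have hexp : 1 ≤ Real.exp (B.amplitude μ (W t) l₀ ^ 2 / 2) := Real.one_le_exp (by positivity)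
  calc μ l₀ k ^ 2 / rowNorm μ l₀ * B.amplitude μ (W t) l₀
      ≤ Real.exp (B.amplitude μ (W t) l₀ ^ 2 / 2) *
        (μ l₀ k ^ 2 / rowNorm μ l₀ * B.amplitude μ (W t) l₀) :=
        le_mul_of_one_le_left (by positivity) hexp
    _ = _ := by ring

theorem IsTraining.exists_abs_blockWeight_le (hW : B.IsTraining P x ℓ T W z)
    (hB : B.OrthogonalEmbeddings) (h : B.StationaryOn P x ℓ S μ ν)
    (hmem : ∀ t : ℝ, 0 < t → (t : EReal) < T → (W t, z t) ∈ S) (hT : 0 < T)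
    {l l₀ : Fin M} (hlt : rowNorm μ l < rowNorm μ l₀) (k : Fin n) :
    ∃ K : ℝ, ∀ᶠ t in timeTo T, |B.blockWeight μ (W t) k l| ≤ K := by
  obtain ⟨K, hK⟩ := hW.exists_amplitude_le hB h hmem hT hlt
  refine ⟨Real.exp (K ^ 2 / 2) * |μ l k| * K, ?_⟩
  filter_upwards [eventually_timeTo (t₀ := 0) hT] with t ht
  have ha := hW.amplitude_nonneg hB h hmem ht.1.le ht.2 l
  have haK := hK t ht.1.le ht.2
  rw [blockWeight, hW.jointLogits_eq hB h hmem ht.1.le ht.2,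
    hW.logit_eq hB h hmem ht.1.le ht.2, abs_mul, abs_mul, Real.abs_exp]
  gcongr
  exact (hW.abs_v_le hB h hmem ht.1.le ht.2 l k).trans haK

end STB

/-! ### The limit of the normalized blocks -/

/-- In a linear combination of functions of which only one diverges, that one gives the limit of the
normalized combination. -/
theorem tendsto_sum_mul_div_of_dominant {ι α : Type*} [Fintype ι] [DecidableEq ι] {F : Filter α}
    {q : ι → α → ℝ} {i₀ : ι} (h₀ : Tendsto (q i₀) F atTop)
    (hq : ∀ i, i ≠ i₀ → ∃ K, ∀ᶠ t in F, |q i t| ≤ K) (c : ι → ℝ) :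
    Tendsto (fun t => (∑ i, c i * q i t) / q i₀ t) F (𝓝 (c i₀)) := by
  have hterm : ∀ i, Tendsto (fun t => c i * (q i t / q i₀ t)) F
      (𝓝 (if i = i₀ then c i₀ else 0)) := by
    intro i
    by_cases hi : i = i₀
    · subst hi
      refine tendsto_const_nhds.congr' ?_
      filter_upwards [h₀.eventually_ne_atTop 0] with t ht
      simp [ht]
    · obtain ⟨K, hK⟩ := hq i hi
      have h1 : Tendsto (fun t => q i t / q i₀ t) F (𝓝 0) := by
        refine squeeze_zero_norm' ?_ (h₀.const_div_atTop K)
        filter_upwards [hK, h₀.eventually_gt_atTop 0] with t ht hpos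
        rw [Real.norm_eq_abs, abs_div, abs_of_pos hpos]
        gcongr
      simpa [hi] using h1.const_mul (c i)
  have := tendsto_finsetSum Finset.univ fun i _ => hterm i
  simpa [Finset.sum_div, mul_div_assoc] using this

theorem mainTheorem3 {d M n : ℕ} (B : STB d M n) (hB : B.OrthogonalEmbeddings)
    {Ω : Type*} [MeasurableSpace Ω] (P : Measure Ω) [IsProbabilityMeasure P]
    (x : Ω → Fin M → ℝ) (ℓ : Ω → (Fin n → ℝ) → ℝ)
    (T : EReal) (hT : 0 < T)
    (W : ℝ → Matrix (Fin d) (Fin n) ℝ) (z : ℝ → Fin M → ℝ)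
    (hW : B.IsTraining P x ℓ T W z) (hlife : STB.IsLifetime T W z)
    (S : Set (Matrix (Fin d) (Fin n) ℝ × (Fin M → ℝ))) (hS : IsOpen S)
    (hmem : ∀ t : ℝ, 0 < t → (t : EReal) < T → (W t, z t) ∈ S)
    (μ : Matrix (Fin M) (Fin n) ℝ) (ν : Fin n → ℝ)
    (hstat : B.StationaryOn P x ℓ S μ ν)
    (l₀ : Fin M)
    (hmax : ∀ l, l ≠ l₀ → ∑ k, (μ l k) ^ 2 < ∑ k, (μ l₀ k) ^ 2)
    (hne : ∀ k, μ l₀ k ≠ 0)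
    (hsum : ∑ s, B.UC s l₀ ≠ 0) :
    (∀ k, ∀ᶠ t in timeTo T, B.blockSum P x ℓ (W t) k ≠ 0) ∧
    ∃ A : Matrix (Fin d) (Fin d) ℝ, ∀ k s s',
      Tendsto (fun t => B.hessian P x ℓ (W t) s k s' k / B.blockSum P x ℓ (W t) k)
        (timeTo T) (𝓝 (A s s')) := by
  have hlt : ∀ l, l ≠ l₀ → STB.rowNorm μ l < STB.rowNorm μ l₀ := fun l hl =>
    Real.sqrt_lt_sqrt (Finset.sum_nonneg fun _ _ => sq_nonneg _) (hmax l hl)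
  have hle : ∀ l, STB.rowNorm μ l ≤ STB.rowNorm μ l₀ := fun l => by
    rcases eq_or_ne l l₀ with rfl | hl
    exacts [le_rfl, (hlt l hl).le]
  -- for `n = 0` the row norms vanish, so positivity needs a hidden unit
  have hpos : ∀ _ : Fin n, 0 < STB.rowNorm μ l₀ := fun k =>
    (abs_pos.2 (hne k)).trans_le (STB.abs_le_rowNorm l₀ k)
  have hdom : ∀ k (c : Fin M → ℝ), Tendsto (fun t =>
      (∑ l, c l * B.blockWeight μ (W t) k l) / B.blockWeight μ (W t) k l₀) (timeTo T)
      (𝓝 (c l₀)) := fun k =>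
    tendsto_sum_mul_div_of_dominant (q := fun l t => B.blockWeight μ (W t) k l)
      (hW.tendsto_blockWeight hB hstat hmem hT hlife (hpos k) hle (hne k))
      fun l hl => hW.exists_abs_blockWeight_le hB hstat hmem hT (hlt l hl) k
  have hhess : ∀ᶠ t in timeTo T, ∀ k s s', B.hessian P x ℓ (W t) s k s' k =
      ∑ l, B.UC s l * B.UC s' l * B.blockWeight μ (W t) k l := by
    filter_upwards [eventually_timeTo (t₀ := 0) hT] with t ht k s s'
    refine hstat.hessian_eq hS ?_ s k s' k
    rw [hW.jointLogits_eq hB hstat hmem ht.1.le ht.2]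
    exact hmem t ht.1 ht.2
  have hblock : ∀ᶠ t in timeTo T, ∀ k, B.blockSum P x ℓ (W t) k =
      ∑ l, (∑ s, B.UC s l) ^ 2 * B.blockWeight μ (W t) k l := by
    filter_upwards [hhess] with t ht k
    simp only [STB.blockSum, ht]
    refine (Finset.sum_congr rfl fun _ _ => Finset.sum_comm).trans (Finset.sum_comm.trans ?_)
    refine Finset.sum_congr rfl fun l _ => ?_
    rw [pow_two, Finset.sum_mul_sum]
    simp only [Finset.sum_mul]
  have hblockLim : ∀ k, Tendsto (fun t => B.blockSum P x ℓ (W t) k /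
      B.blockWeight μ (W t) k l₀) (timeTo T) (𝓝 ((∑ s, B.UC s l₀) ^ 2)) := fun k =>
    (hdom k fun l => (∑ s, B.UC s l) ^ 2).congr' (hblock.mono fun t ht => by simp only [ht k])
  refine ⟨fun k => ?_,
    Matrix.of fun s s' => B.UC s l₀ * B.UC s' l₀ / (∑ s, B.UC s l₀) ^ 2, fun k s s' => ?_⟩
  · filter_upwards [(hblockLim k).eventually_ne (pow_ne_zero 2 hsum)] with t ht h0
    exact ht (by rw [h0, zero_div])
  · refine (((hdom k fun l => B.UC s l * B.UC s' l).div (hblockLim k)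
      (pow_ne_zero 2 hsum))).congr' ?_
    filter_upwards [hhess, (hW.tendsto_blockWeight hB hstat hmem hT hlife (hpos k) hle
      (hne k)).eventually_ne_atTop 0] with t ht hq
    rw [ht k s s', Pi.div_apply, div_div_div_cancel_right₀ hq]
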